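/- Let $\mathscr X$ be a non-empty finite set, $\mathscr X^*=\bigcup_{n\ge 0}\mathscr X^n$ the set of situations (finite strings of states) and $\Omega=\mathscr X^{\mathbb N}$ the set of paths, where $\mathbb N=\{1,2,\dots\}$. For $\omega\in\Omega$, let $\omega^n\in\mathscr X^n$ be the string of its first $n$ states, and for $s\in\mathscr X^n$ let $\Gamma(s)=\{\omega\in\Omega:\omega^n=s\}$. A function with values in $\overline{\mathbb R}=\mathbb R\cup\{-\infty,+\infty\}$ is called bounded below if it is $\ge B$ everywhere for some $B\in\mathbb R$; a gamble is a bounded real-valued function. An upper expectation on the set of all functions $\mathscr X\to\overline{\mathbb R}$ is a map $\overline{\mathrm E}$ from this set to $\overline{\mathbb R}$ such that 1. $\overline{\mathrm E}(c)=c$ for every real constant $c$; 2. $\overline{\mathrm E}(f+g)\le\overline{\mathrm E}(f)+\overline{\mathrm E}(g)$ for all bounded below $f,g$; 3. $\overline{\mathrm E}(\lambda f)=\lambda\overline{\mathrm E}(f)$ for all real $\lambda>0$ and all bounded below $f$; 4. $\overline{\mathrm E}(f)\le\overline{\mathrm E}(g)$ for all bounded below $f,g$ with $f\le g$; 5. $\lim_{n\to+\infty}\overline{\mathrm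 E}(f_n)=\overline{\mathrm E}(\lim_{n\to+\infty}f_n)$ for every non-decreasing sequence $(f_n)$ of non-negative functions. Let an upper expectation $\overline{\mathrm Q}_s$ of this kind be given for every $s\in\mathscr X^*$ (an imprecise probabilities tree). A supermartingale is a map $\mathscr M:\mathscr X^*\to\overline{\mathbb R}$ such that $\overline{\mathrm Q}_s(\mathscr M(s\,\cdot))\le\mathscr M(s)$ for all $s\in\mathscr X^*$, where $\mathscr M(s\,\cdot)$ is the function $x\mapsto\mathscr M(sx)$ on $\mathscr X$. The game-theoretic upper expectation of $f:\Omega\to\overline{\mathbb R}$ conditional on $s\in\mathscr X^*$ is $$\overline{\mathrm E}_{\mathrm V}(f\vert s)=\inf\Big\{\mathscr M(s):\ \mathscr M\text{ is a bounded below supermartingale and }\liminf_{n\to+\infty}\mathscr M(\omega^n)\ge f(\omega)\text{ for all }\omega\in\Gamma(s)\Big\}.$$ A function $f:\Omega\to\overline{\mathbb R}$ is $n$-measurable if it is constant on $\Gamma(s)$ for every $s\in\mathscr X^n$, and finitary if it is $n$-measurable for some $n\ge 0$. Let $\overline{\mathbb V}_{b,\lim}$ be the set of all bounded below $f:\Omega\to\overline{\mathbb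 R}$ that are the pointwise limit of some sequence of finitary functions $\Omega\to\overline{\mathbb R}$. Theorem. For every $s\in\mathscr X^*$ and every $f\in\overline{\mathbb V}_{b,\lim}$ there is a sequence $(f_n)_{n\ge 0}$ of gambles on $\Omega$, with $f_n$ being $n$-measurable for every $n\ge 0$, that is uniformly bounded below (there is $B\in\mathbb R$ with $f_n\ge B$ for all $n$), that converges pointwise to $f$, and for which $\lim_{n\to+\infty}\overline{\mathrm E}_{\mathrm V}(f_n\vert s)=\overline{\mathrm E}_{\mathrm V}(f\vert s)$. -/

import Mathlib

open Filter Topology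

namespace GameTheoretic

universe u

/-! ### Variables on a set -/

/-- An extended real variable is bounded below (by a real number). -/
def IsBddBelow {Y : Type u} (f : Y → EReal) : Prop :=
  ∃ B : ℝ, ∀ y, (B : EReal) ≤ f y

/-- An extended real variable is bounded above (by a real number). -/
def IsBddAbove {Y : Type u} (f : Y → EReal) : Prop :=
  ∃ B : ℝ, ∀ y, f y ≤ (B : EReal)

/-- A gamble: a real-valued, bounded variable. -/
def IsGamble {Y : Type u} (f : Y → EReal) : Prop :=
  (∀ y, ∃ r : ℝ, f y = (r : EReal)) ∧ IsBddBelow f ∧ IsBddAbove f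

/-- One real lower bound serves for all the variables of the sequence. -/
def IsUniformlyBddBelow {Y : Type u} (f : ℕ → Y → EReal) : Prop :=
  ∃ B : ℝ, ∀ n y, (B : EReal) ≤ f n y

/-- Pointwise convergence, in the order topology of the extended reals. -/
def ConvergesPointwise {Y : Type u} (f : ℕ → Y → EReal) (g : Y → EReal) : Prop :=
  ∀ y, Tendsto (fun n => f n y) atTop (𝓝 (g y))

/-- Upper expectations on the set of all extended real variables on `Y`. Sublinearity,
homogeneity and monotonicity are required on the variables that are bounded below only, so
no sum of opposite infinities occurs. -/
structure IsUpperExpectation {Y : Type u} (E : (Y → EReal) → EReal) : Prop where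
  const : ∀ c : ℝ, E (fun _ => (c : EReal)) = (c : EReal)
  sublinear : ∀ f g : Y → EReal, IsBddBelow f → IsBddBelow g →
    E (fun y => f y + g y) ≤ E f + E g
  homogeneous : ∀ (r : ℝ) (f : Y → EReal), 0 < r → IsBddBelow f →
    E (fun y => (r : EReal) * f y) = (r : EReal) * E f
  monotone : ∀ f g : Y → EReal, IsBddBelow f → IsBddBelow g → (∀ y, f y ≤ g y) → E f ≤ E g
  continuous : ∀ (f : ℕ → Y → EReal) (g : Y → EReal), (∀ n y, 0 ≤ f n y) →
    (∀ n y, f n y ≤ f (n + 1) y) → ConvergesPointwise f g →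
    Tendsto (fun n => E (f n)) atTop (𝓝 (E g))

/-! ### Situations, paths and imprecise probabilities trees -/

/-- A situation: a finite string of states; the empty list is the initial situation. -/
abbrev Situation (X : Type u) : Type u := List X

/-- A path: an infinite sequence of states; `ω k` is the state at time `k + 1`. -/
abbrev Path (X : Type u) : Type u := ℕ → X

/-- The situation formed by the first `n` states of a path. -/
def Path.initial {X : Type u} (ω : Path X) (n : ℕ) : Situation X :=
  (List.range n).map ω

/-- The cylinder event of a situation: the set of paths that go through it. -/
def cylinder {X : Type u} (s : Situation X) : Set (Path X) :=
  {ω | Path.initial ω s.length = s}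

/-- An imprecise probabilities tree: a local upper expectation for every situation. -/
structure ImpreciseProbabilitiesTree (X : Type u) where
  /-- The local upper expectation in a situation. -/
  local' : Situation X → (X → EReal) → EReal
  isUpperExpectation : ∀ s, IsUpperExpectation (local' s)

/-- A supermartingale for the tree `T`. -/
def ImpreciseProbabilitiesTree.IsSupermartingale {X : Type u}
    (T : ImpreciseProbabilitiesTree X) (M : Situation X → EReal) : Prop :=
  ∀ s : Situation X, T.local' s (fun x => M (s ++ [x])) ≤ M s

/-- The limit inferior of a process along a path. -/
noncomputable def processLiminf {X : Type u} (M : Situation X → EReal) (ω : Path X) : EReal :=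
  liminf (fun n => M (Path.initial ω n)) atTop

/-- The global game-theoretic upper expectation of `f` conditional on the situation `s`. -/
noncomputable def ImpreciseProbabilitiesTree.upperExp {X : Type u}
    (T : ImpreciseProbabilitiesTree X) (f : Path X → EReal) (s : Situation X) : EReal :=
  sInf {a | ∃ M : Situation X → EReal, T.IsSupermartingale M ∧ IsBddBelow M ∧
    (∀ ω ∈ cylinder s, f ω ≤ processLiminf M ω) ∧ a = M s}

/-! ### Finitary variables and their limits -/

/-- A global variable is `n`-measurable: constant on the cylinder of every situation of
length `n`. -/
def IsNMeasurable {X : Type u} (n : ℕ) (f : Path X → EReal) : Prop :=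
  ∀ s : Situation X, s.length = n → ∀ ω ∈ cylinder s, ∀ ω' ∈ cylinder s, f ω = f ω'

/-- A global variable is finitary. -/
def IsFinitary {X : Type u} (f : Path X → EReal) : Prop :=
  ∃ n : ℕ, IsNMeasurable n f

/-- The set of bounded below pointwise limits of sequences of finitary variables. -/
def boundedLimits (X : Type u) : Set (Path X → EReal) :=
  {f | IsBddBelow f ∧ ∃ g : ℕ → Path X → EReal, (∀ n, IsFinitary (g n)) ∧ ConvergesPointwise g f}

end GameTheoretic

namespace GameTheoretic

universe u

/-! ### Upper expectations on a set -/

section Local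

variable {Y : Type u} {E : (Y → EReal) → EReal}

/-! After truncation and reindexing, `f` is the pointwise limit of gambles `G n ≥ B`, the `n`-th
being `n`-measurable. Let `H m n` be the minimum of `G m, …, G n` and `h m` the infimum of all `G i`
with `i ≥ m`. Then `H m n` decreases to `h m` as `n` grows, and `h m` increases to `f`. The upper
expectation is continuous along both limits, so `H (k n) n`, with `k n` tending to infinity slowly
enough, has the right limit and the right upper expectations.

Both continuity results rest on optional switching, `upperExp_le_of_stopping`. Downward continuity
(`exists_upperExp_le_of_antitone`) is compactness of the path space: a superhedge of `h m`, raised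
by `ε`, overtakes the decreasing finitary gambles within a bounded time.

Upward continuity (`upperExp_le_iSup`) is the harder half. The supremum `V` of the conditional upper
expectations of the `h m` is a supermartingale, but its limit inferior may lie below `f` on some
paths. A one-sided Lévy zero-one law (`upperExp_raise_le`) shows that the paths on which the limit
inferior for `h m` is more than `δ` below `h m` are negligible: `exists_supermartingale_large` makes
a supermartingale of arbitrarily small initial value large there. A countable sum of these repairs
`V` at arbitrarily small cost. -/

theorem IsBddBelow.add_const {f : Y → EReal} (hf : IsBddBelow f) (c : ℝ) :
    IsBddBelow fun y => f y + (c : EReal) := by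
  obtain ⟨B, hB⟩ := hf
  exact ⟨B + c, fun y => by rw [EReal.coe_add]; exact add_le_add_left (hB y) _⟩

theorem IsUpperExpectation.add_const_le (hE : IsUpperExpectation E) {f : Y → EReal}
    (hf : IsBddBelow f) (c : ℝ) : E (fun y => f y + (c : EReal)) ≤ E f + (c : EReal) := by
  have h := hE.sublinear f (fun _ => (c : EReal)) hf ⟨c, fun _ => le_rfl⟩
  rwa [hE.const] at h

theorem IsUpperExpectation.exists_le [Finite Y] [Nonempty Y] (hE : IsUpperExpectation E)
    {f : Y → EReal} (hf : IsBddBelow f) : ∃ y, f y ≤ E f := by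
  obtain ⟨y, hy⟩ := Finite.exists_min f
  -- The minimum `f y` may be `⊤`, whereas `const` speaks of real constants only; hence the
  -- comparison with every real `r < f y`.
  refine ⟨y, EReal.ge_of_forall_gt_iff_ge.1 fun r hr => ?_⟩
  rw [← hE.const r]
  exact hE.monotone _ _ ⟨r, fun _ => le_rfl⟩ hf fun z => hr.le.trans (hy z)

/-- Upward continuity for variables with a common real lower bound. -/
theorem IsUpperExpectation.le_of_monotone_limit (hE : IsUpperExpectation E)
    {f : ℕ → Y → EReal} {g : Y → EReal} {B : ℝ} (hB : ∀ n y, (B : EReal) ≤ f n y)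
    (hmono : ∀ n y, f n y ≤ f (n + 1) y) (hlim : ConvergesPointwise f g)
    {a : EReal} (ha : ∀ n, E (f n) ≤ a) : E g ≤ a := by
  have hg : ∀ y, (B : EReal) ≤ g y := fun y =>
    ge_of_tendsto (hlim y) (Eventually.of_forall fun n => hB n y)
  -- `continuous` needs non-negative functions, so everything is shifted by `-B`; subadditivity
  -- controls the shift in both directions.
  have hgB : IsBddBelow fun y => g y + ((-B : ℝ) : EReal) := IsBddBelow.add_const ⟨B, hg⟩ _
  have hsub : E (fun y => g y + ((-B : ℝ) : EReal)) ≤ a + ((-B : ℝ) : EReal) := by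
    refine le_of_tendsto
      (hE.continuous (fun n y => f n y + ((-B : ℝ) : EReal)) _ ?_ ?_ ?_)
      (Eventually.of_forall fun n => (hE.add_const_le ⟨B, hB n⟩ _).trans
        (add_le_add_left (ha n) _))
    · intro n y
      have := add_le_add_left (hB n y) ((-B : ℝ) : EReal)
      rwa [← EReal.coe_add, add_neg_cancel, EReal.coe_zero] at this
    · exact fun n y => add_le_add_left (hmono n y) _
    · intro y
      exact (EReal.continuousAt_add (p := (g y, ((-B : ℝ) : EReal))) (by simp) (by simp)).tendsto.comp
        ((hlim y).prodMk_nhds tendsto_const_nhds)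
  have h1 := hE.add_const_le hgB B
  have cancel : ∀ x : EReal, x + ((-B : ℝ) : EReal) + (B : EReal) = x := fun x => by
    rw [EReal.coe_neg, ← sub_eq_add_neg, EReal.sub_add_cancel]
  simp only [cancel] at h1
  exact h1.trans ((add_le_add_left hsub _).trans (cancel a).le)

end Local

/-! ### Paths and cylinders -/

section Paths

variable {X : Type u}

@[simp] theorem Path.length_initial (ω : Path X) (n : ℕ) : (ω.initial n).length = n := by
  simp [Path.initial]

theorem Path.initial_succ (ω : Path X) (n : ℕ) : ω.initial (n + 1) = ω.initial n ++ [ω n] := by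
  simp [Path.initial, List.range_succ]

theorem Path.mem_cylinder_initial (ω : Path X) (n : ℕ) : ω ∈ cylinder (ω.initial n) := by
  simp [cylinder]

theorem Path.take_initial (ω : Path X) {m n : ℕ} (h : m ≤ n) :
    (ω.initial n).take m = ω.initial m := by
  simp [Path.initial, ← List.map_take, List.take_range, h]

theorem mem_cylinder_of_prefix {s : Situation X} {ω : Path X} {n : ℕ} (h : s <+: ω.initial n) :
    ω ∈ cylinder s := by
  have hl : s.length ≤ n := by simpa using h.length_le
  change ω.initial s.length = s
  rw [← ω.take_initial hl]
  exact (List.prefix_iff_eq_take.1 h).symm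

theorem cylinder_subset {s t : Situation X} (h : s <+: t) : cylinder t ⊆ cylinder s := by
  intro ω hω
  refine mem_cylinder_of_prefix (n := t.length) ?_
  rwa [show ω.initial t.length = t from hω]

/-- A path through `s` that follows a given selection of successors from `s` onwards. -/
theorem exists_path_following [Nonempty X] (next : Situation X → X) (s : Situation X) :
    ∃ ω ∈ cylinder s, ∀ n, s.length ≤ n → ω n = next (ω.initial n) := by
  classical
  -- The first `s.length` states are copied from `s`; the selection takes over afterwards.
  let step : Situation X → X := fun u => if h : u.length < s.length then s[u.length] else next u
  let sit : ℕ → Situation X := fun n => Nat.rec [] (fun _ u => u ++ [step u]) n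
  let ω : Path X := fun n => step (sit n)
  have hsit : ∀ n, ω.initial n = sit n := by
    intro n
    induction n with
    | zero => rfl
    | succ n ih => rw [Path.initial_succ, ih]
  refine ⟨ω, ?_, fun n hn => ?_⟩
  · change ω.initial s.length = s
    refine List.ext_getElem (by simp) fun i h1 h2 => ?_
    have : ω i = s[i] := by
      have hl : (sit i).length = i := by rw [← hsit]; simp
      simp [ω, step, hl, h2]
    simpa [Path.initial] using this
  · have hl : (sit n).length = n := by rw [← hsit]; simp
    rw [hsit]
    exact dif_neg (by omega)

theorem le_processLiminf_of_le {M : Situation X → EReal} {a : EReal} (h : ∀ u, a ≤ M u)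
    (ω : Path X) : a ≤ processLiminf M ω :=
  le_liminf_of_le (by isBoundedDefault) (Eventually.of_forall fun _ => h _)

theorem processLiminf_mono {M M' : Situation X → EReal} (h : ∀ u, M u ≤ M' u) (ω : Path X) :
    processLiminf M ω ≤ processLiminf M' ω :=
  liminf_le_liminf (Eventually.of_forall fun _ => h _)

theorem processLiminf_add_const_le (M : Situation X → EReal) (c : ℝ) (ω : Path X) :
    processLiminf M ω + (c : EReal) ≤ processLiminf (fun u => M u + (c : EReal)) ω := by
  have h := EReal.le_liminf_add (f := (atTop : Filter ℕ)) (u := fun n => M (ω.initial n))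
    (v := fun _ => (c : EReal))
  rwa [liminf_const] at h

end Paths

namespace ImpreciseProbabilitiesTree

variable {X : Type u} {T : ImpreciseProbabilitiesTree X}

/-! ### Supermartingales and the global upper expectation -/

theorem isSupermartingale_const (c : ℝ) : T.IsSupermartingale fun _ => (c : EReal) :=
  fun s => ((T.isUpperExpectation s).const c).le

theorem IsSupermartingale.add_const {M : Situation X → EReal} (hM : T.IsSupermartingale M)
    (hb : IsBddBelow M) (c : ℝ) : T.IsSupermartingale fun u => M u + (c : EReal) := by
  intro s
  obtain ⟨B, hB⟩ := hb
  exact ((T.isUpperExpectation s).add_const_le ⟨B, fun x => hB _⟩ c).trans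
    (add_le_add_left (hM s) _)

theorem IsSupermartingale.add {M M' : Situation X → EReal} (hM : T.IsSupermartingale M)
    (hM' : T.IsSupermartingale M') (hb : IsBddBelow M) (hb' : IsBddBelow M') :
    T.IsSupermartingale fun u => M u + M' u := by
  intro s
  obtain ⟨B, hB⟩ := hb
  obtain ⟨B', hB'⟩ := hb'
  exact ((T.isUpperExpectation s).sublinear _ _ ⟨B, fun x => hB _⟩ ⟨B', fun x => hB' _⟩).trans
    (add_le_add (hM s) (hM' s))

theorem IsSupermartingale.const_mul {M : Situation X → EReal} (hM : T.IsSupermartingale M)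
    (hb : IsBddBelow M) {r : ℝ} (hr : 0 < r) :
    T.IsSupermartingale fun u => (r : EReal) * M u := by
  intro s
  obtain ⟨B, hB⟩ := hb
  rw [(T.isUpperExpectation s).homogeneous r _ hr ⟨B, fun x => hB _⟩]
  exact mul_le_mul_of_nonneg_left (hM s) (by exact_mod_cast hr.le)

theorem upperExp_le {f : Path X → EReal} {s : Situation X} {M : Situation X → EReal}
    (hM : T.IsSupermartingale M) (hb : IsBddBelow M)
    (hf : ∀ ω ∈ cylinder s, f ω ≤ processLiminf M ω) : T.upperExp f s ≤ M s :=
  sInf_le ⟨M, hM, hb, hf, rfl⟩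

theorem upperExp_mono {f g : Path X → EReal} {s : Situation X}
    (h : ∀ ω ∈ cylinder s, f ω ≤ g ω) : T.upperExp f s ≤ T.upperExp g s := by
  refine le_sInf ?_
  rintro a ⟨M, hM, hb, hg, rfl⟩
  exact upperExp_le hM hb fun ω hω => (h ω hω).trans (hg ω hω)

theorem upperExp_le_const {f : Path X → EReal} {s : Situation X} {c : ℝ}
    (h : ∀ ω ∈ cylinder s, f ω ≤ (c : EReal)) : T.upperExp f s ≤ (c : EReal) :=
  upperExp_le (M := fun _ => (c : EReal)) (isSupermartingale_const c) ⟨c, fun _ => le_rfl⟩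
    fun ω hω => (h ω hω).trans (le_processLiminf_of_le (fun _ => le_rfl) ω)

/-- Countable sums of non-negative supermartingales are supermartingales. -/
theorem IsSupermartingale.tsum {L : ℕ → Situation X → EReal}
    (hL : ∀ m, T.IsSupermartingale (L m)) (h0 : ∀ m u, 0 ≤ L m u) :
    T.IsSupermartingale fun u => ((∑' m, (L m u).toENNReal : ENNReal) : EReal) := by
  intro u
  have hE := T.isUpperExpectation u
  have hnn : ∀ a : ENNReal, ((0 : ℝ) : EReal) ≤ (a : EReal) := fun a =>
    EReal.coe_ennreal_nonneg a
  have partial_le : ∀ n, T.local' u (fun x =>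
      ((∑ m ∈ Finset.range n, (L m (u ++ [x])).toENNReal : ENNReal) : EReal)) ≤
        ((∑ m ∈ Finset.range n, (L m u).toENNReal : ENNReal) : EReal) := by
    intro n
    induction n with
    | zero => simpa using (hE.const 0).le
    | succ n ih =>
      simp only [Finset.sum_range_succ, EReal.coe_ennreal_add, EReal.coe_toENNReal (h0 n _)]
      exact (hE.sublinear _ _ ⟨0, fun _ => hnn _⟩ ⟨0, fun _ => h0 _ _⟩).trans
        (add_le_add ih (hL n u))
  -- The partial sums increase to the series, so local upward continuity passes the bound to the
  -- limit.
  refine hE.le_of_monotone_limit (B := 0) (fun _ _ => hnn _) (fun n x => ?_) (fun x => ?_)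
    fun n => (partial_le n).trans (EReal.coe_ennreal_le_coe_ennreal_iff.2 (ENNReal.sum_le_tsum _))
  · rw [EReal.coe_ennreal_le_coe_ennreal_iff, Finset.sum_range_succ]
    exact le_self_add
  · exact EReal.tendsto_coe_ennreal.2 (ENNReal.tendsto_nat_tsum _)

variable [Finite X] [Nonempty X]

/-- A supermartingale cannot lie below its limit inferior on every path. -/
theorem IsSupermartingale.le_of_le_liminf {M : Situation X → EReal} (hM : T.IsSupermartingale M)
    (hb : IsBddBelow M) {s : Situation X} {a : EReal}
    (h : ∀ ω ∈ cylinder s, a ≤ processLiminf M ω) : a ≤ M s := by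
  -- A local upper expectation is at least the minimum of its argument, so some successor does not
  -- increase `M`. Along the path that keeps choosing such successors, `M` never exceeds `M s` after
  -- `s`.
  have hnext : ∀ u, ∃ x, M (u ++ [x]) ≤ M u := fun u => by
    obtain ⟨B, hB⟩ := hb
    obtain ⟨x, hx⟩ := (T.isUpperExpectation u).exists_le
      (f := fun x => M (u ++ [x])) ⟨B, fun x => hB _⟩
    exact ⟨x, hx.trans (hM u)⟩
  choose next hnext using hnext
  obtain ⟨ω, hω, hfollow⟩ := exists_path_following next s
  have hle : ∀ n, s.length ≤ n → M (ω.initial n) ≤ M s := by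
    intro n hn
    induction n, hn using Nat.le_induction with
    | base => rw [show ω.initial s.length = s from hω]
    | succ n hn ih =>
      rw [Path.initial_succ, hfollow n hn]
      exact (hnext _).trans ih
  refine (h ω hω).trans ?_
  refine (liminf_le_liminf (v := fun _ => M s) ?_).trans (liminf_const _).le
  filter_upwards [eventually_ge_atTop s.length] with n hn using hle n hn

theorem le_upperExp {f : Path X → EReal} {s : Situation X} {a : EReal}
    (h : ∀ ω ∈ cylinder s, a ≤ f ω) : a ≤ T.upperExp f s := by
  refine le_sInf ?_
  rintro b ⟨M, hM, hb, hf, rfl⟩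
  exact hM.le_of_le_liminf hb fun ω hω => (h ω hω).trans (hf ω hω)

/-- The supermartingales in the definition of the global upper expectation may be taken to
respect the lower bound of the variable. -/
theorem exists_superhedge {f : Path X → EReal} {B : ℝ} (hB : ∀ ω, (B : EReal) ≤ f ω)
    {s : Situation X} {a : EReal} (ha : T.upperExp f s < a) :
    ∃ M, T.IsSupermartingale M ∧ (∀ u, (B : EReal) ≤ M u) ∧
      (∀ ω ∈ cylinder s, f ω ≤ processLiminf M ω) ∧ M s < a := by
  classical
  obtain ⟨_, ⟨M, hM, hb, hf, rfl⟩, hMa⟩ := sInf_lt_iff.1 ha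
  -- Off the extensions of `s` the value `⊤` makes both conditions trivial. On an extension `u`, the
  -- limit inferior of `M` is at least `B` on the whole cylinder, which forces `B ≤ M u`.
  refine ⟨fun u => if s <+: u then M u else ⊤, fun u => ?_, fun u => ?_, fun ω hω => ?_, ?_⟩
  · by_cases hu : s <+: u
    · have : ∀ x, s <+: u ++ [x] := fun x => hu.trans (List.prefix_append _ _)
      simpa [hu, this] using hM u
    · simp [hu]
  · by_cases hu : s <+: u
    · simp only [hu, if_true]
      exact hM.le_of_le_liminf hb fun ω hω => (hB ω).trans (hf ω (cylinder_subset hu hω))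
    · simp [hu]
  · refine (hf ω hω).trans (processLiminf_mono (fun u => ?_) ω)
    split_ifs <;> simp
  · simpa using hMa

/-- A superhedge from `s` is also one from each successor of `s`, whose cylinder is smaller. Local
monotonicity compares the two, and the infimum over superhedges finishes. -/
theorem isSupermartingale_upperExp {f : Path X → EReal} (hf : IsBddBelow f) :
    T.IsSupermartingale (T.upperExp f) := by
  intro s
  obtain ⟨B, hB⟩ := hf
  refine le_sInf ?_
  rintro a ⟨M, hM, ⟨B', hB'⟩, hfM, rfl⟩
  refine ((T.isUpperExpectation s).monotone _ _ ⟨B, fun x => le_upperExp fun ω _ => hB ω⟩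
    ⟨B', fun x => hB' _⟩ fun x => ?_).trans (hM s)
  exact upperExp_le hM ⟨B', hB'⟩ fun ω hω =>
    hfM ω (cylinder_subset (List.prefix_append _ _) hω)

/-- Optional switching: a supermartingale that, on each path, either superhedges `f` in the limit
or exceeds at some moment what is needed to superhedge `f` from then on. -/
theorem upperExp_le_of_stopping {f : Path X → EReal} (hf : IsBddBelow f) {s : Situation X}
    {M : Situation X → EReal} (hM : T.IsSupermartingale M) (hb : IsBddBelow M)
    (h : ∀ ω ∈ cylinder s, f ω ≤ processLiminf M ω ∨
      ∃ n, s.length ≤ n ∧ T.upperExp f (ω.initial n) < M (ω.initial n)) :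
    T.upperExp f s ≤ M s := by
  classical
  obtain ⟨B, hB⟩ := hf
  obtain ⟨B', hB'⟩ := hb
  -- The situations in which `M` can pay for a fresh superhedge of `f`.
  let S : Situation X → Prop := fun t => s.length ≤ t.length ∧ T.upperExp f t < M t
  have hN : ∀ t, ∃ N : Situation X → EReal, S t → T.IsSupermartingale N ∧
      (∀ u, (B : EReal) ≤ N u) ∧ (∀ ω ∈ cylinder t, f ω ≤ processLiminf N ω) ∧ N t < M t := by
    intro t
    by_cases ht : S t
    · obtain ⟨N, hN⟩ := exists_superhedge hB ht.2
      exact ⟨N, fun _ => hN⟩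
    · exact ⟨M, fun h => absurd h ht⟩
  choose N hN using hN
  -- `inits` lists prefixes by increasing length, so `first u` is the earliest switching point on
  -- the way to `u`. The process `W` follows `M` up to it and then the superhedge `N t` chosen
  -- there; switching only lowers the value.
  let first : Situation X → Option (Situation X) := fun u => u.inits.find? fun t => decide (S t)
  let W : Situation X → EReal := fun u => (first u).elim (M u) fun t => N t u
  have first_some : ∀ {u t}, first u = some t → S t ∧ t <+: u := fun {u t} hu =>
    ⟨by simpa using List.find?_some hu, (List.mem_inits _ _).1 (List.mem_of_find?_eq_some hu)⟩
  have first_none : ∀ {u}, first u = none → ∀ t, t <+: u → ¬ S t := fun {u} hu t ht => by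
    simpa using List.find?_eq_none.1 hu t ((List.mem_inits _ _).2 ht)
  have first_succ : ∀ u x, first (u ++ [x]) =
      (first u).or (if S (u ++ [x]) then some (u ++ [x]) else none) := by
    intro u x
    simp only [first, List.inits_append, List.find?_append]
    congr 1
    by_cases hS : S (u ++ [x]) <;> simp [hS]
  have hmin : ((min B B' : ℝ) : EReal) ≤ B ∧ ((min B B' : ℝ) : EReal) ≤ B' :=
    ⟨EReal.coe_le_coe (min_le_left _ _), EReal.coe_le_coe (min_le_right _ _)⟩
  have hW : T.IsSupermartingale W := by
    intro u
    rcases hu : first u with _ | t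
    · have hWu : W u = M u := by simp [W, hu]
      rw [hWu]
      refine ((T.isUpperExpectation u).monotone _ _ ⟨min B B', fun x => ?_⟩
        ⟨B', fun x => hB' _⟩ fun x => ?_).trans (hM u)
      · by_cases hS : S (u ++ [x])
        · simpa [W, first_succ, hu, hS] using hmin.1.trans ((hN _ hS).2.1 (u ++ [x]))
        · simpa [W, first_succ, hu, hS] using hmin.2.trans (hB' (u ++ [x]))
      · by_cases hS : S (u ++ [x])
        · simpa [W, first_succ, hu, hS] using (hN _ hS).2.2.2.le
        · simp [W, first_succ, hu, hS]
    · simpa [W, first_succ, hu] using (hN t (first_some hu).1).1 u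
  have hWb : IsBddBelow W := by
    refine ⟨min B B', fun u => ?_⟩
    rcases hu : first u with _ | t
    · simpa [W, hu] using hmin.2.trans (hB' u)
    · simpa [W, hu] using hmin.1.trans ((hN t (first_some hu).1).2.1 u)
  have hWs : W s ≤ M s := by
    rcases hs : first s with _ | t
    · simp [W, hs]
    · obtain ⟨hSt, hts⟩ := first_some hs
      obtain rfl : t = s := hts.eq_of_length_le hSt.1
      simpa [W, hs] using (hN t hSt).2.2.2.le
  refine (upperExp_le hW hWb fun ω hω => ?_).trans hWs
  by_cases hswitch : ∃ n, S (ω.initial n)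
  · obtain ⟨n, hn⟩ := hswitch
    obtain ⟨t, ht⟩ : ∃ t, first (ω.initial n) = some t := by
      rcases hu : first (ω.initial n) with _ | t
      · exact absurd hn (first_none hu _ List.prefix_rfl)
      · exact ⟨t, rfl⟩
    have hstay : ∀ m, n ≤ m → first (ω.initial m) = some t := by
      intro m hm
      induction m, hm using Nat.le_induction with
      | base => exact ht
      | succ m _ ih => rw [Path.initial_succ, first_succ, ih, Option.some_or]
    obtain ⟨hSt, htn⟩ := first_some ht
    refine ((hN t hSt).2.2.1 ω (mem_cylinder_of_prefix htn)).trans (liminf_le_liminf ?_)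
    filter_upwards [eventually_ge_atTop n] with m hm
    simp [W, hstay m hm]
  · have hnone : ∀ n, first (ω.initial n) = none := by
      intro n
      rcases hu : first (ω.initial n) with _ | t
      · rfl
      · obtain ⟨hSt, htn⟩ := first_some hu
        have htω : ω.initial t.length = t := mem_cylinder_of_prefix htn
        exact absurd ⟨t.length, by rwa [htω]⟩ hswitch
    rcases h ω hω with h1 | ⟨n, hn, hlt⟩
    · refine h1.trans (liminf_le_liminf (Eventually.of_forall fun n => ?_))
      simp [W, hnone n]
    · exact absurd ⟨n, by simpa using hn, hlt⟩ hswitch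

end ImpreciseProbabilitiesTree

namespace ImpreciseProbabilitiesTree

variable {X : Type u} {T : ImpreciseProbabilitiesTree X} [Finite X] [Nonempty X]

/-! ### Convergence of the conditional upper expectations along paths -/

open Classical in
/-- Raising `h` by a constant on the paths along which its conditional upper expectations stay
below it does not increase its upper expectation. -/
theorem upperExp_raise_le {h : Path X → EReal} {B C δ c : ℝ} (hB : ∀ ω, (B : EReal) ≤ h ω)
    (hC : ∀ ω, h ω ≤ (C : EReal)) (hδ : 0 < δ) (hc : 0 ≤ c) (t : Situation X) :
    T.upperExp (fun ω => if processLiminf (T.upperExp h) ω + (δ : EReal) < h ω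
      then h ω + (c : EReal) else h ω) t ≤ T.upperExp h t := by
  set φ : Path X → EReal := fun ω => if processLiminf (T.upperExp h) ω + (δ : EReal) < h ω
      then h ω + (c : EReal) else h ω with hφ
  have hhφ : ∀ ω, h ω ≤ φ ω := fun ω => by
    simp only [hφ]
    split_ifs
    · exact le_add_of_nonneg_right (by exact_mod_cast hc)
    · exact le_rfl
  have hφC : ∀ ω, φ ω ≤ ((C + c : ℝ) : EReal) := fun ω => by
    rw [EReal.coe_add]
    simp only [hφ]
    split_ifs
    · exact add_le_add_left (hC ω) _
    · exact (hC ω).trans (le_add_of_nonneg_right (by exact_mod_cast hc))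
  have hv : ∀ u, ∃ v : ℝ, T.upperExp h u = (v : EReal) ∧ B ≤ v := fun u => by
    have h1 : (B : EReal) ≤ T.upperExp h u := le_upperExp fun ω _ => hB ω
    have h2 : T.upperExp h u ≤ C := upperExp_le_const fun ω _ => hC ω
    lift T.upperExp h u to ℝ using
      ⟨(h2.trans_lt (EReal.coe_lt_top _)).ne, ((EReal.bot_lt_coe _).trans_le h1).ne'⟩ with v
    exact ⟨v, rfl, by exact_mod_cast h1⟩
  choose v hv hvB using hv
  -- If `φ` never costs more than `r` above `h`, it never costs more than `max 0 (r - δ)` above it.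
  -- Superhedge `h` by `M` and add `r'`. On a raised path, at some time `M` exceeds the conditional
  -- expectation of `h` by more than `δ`, so `M + r'` can pay for `φ` from there on; on the other
  -- paths `φ = h`.
  have step : ∀ r : ℝ, 0 ≤ r → (∀ u, T.upperExp φ u ≤ ((v u + r : ℝ) : EReal)) →
      ∀ u, T.upperExp φ u ≤ ((v u + max 0 (r - δ) : ℝ) : EReal) := by
    intro r _ hr u
    set r' := max 0 (r - δ) with hr'
    have hr'0 : 0 ≤ r' := le_max_left _ _
    have hrr' : r ≤ r' + δ := by linarith [le_max_right 0 (r - δ)]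
    refine EReal.le_of_forall_lt_iff_le.1 fun a ha => ?_
    have ha' : T.upperExp h u < ((a - r' : ℝ) : EReal) := by
      rw [hv]
      have : v u + r' < a := by exact_mod_cast ha
      exact_mod_cast (by linarith : v u < a - r')
    obtain ⟨M, hM, hMB, hhM, hMa⟩ := exists_superhedge hB ha'
    have hbound : M u + (r' : EReal) ≤ (a : EReal) := by
      have := add_le_add_left hMa.le (r' : EReal)
      rwa [← EReal.coe_add, sub_add_cancel] at this
    refine le_trans ?_ hbound
    refine upperExp_le_of_stopping ⟨B, fun ω => (hB ω).trans (hhφ ω)⟩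
      (hM.add_const ⟨B, hMB⟩ r') (IsBddBelow.add_const ⟨B, hMB⟩ r') fun ω hω => ?_
    by_cases hN : processLiminf (T.upperExp h) ω + (δ : EReal) < h ω
    · right
      obtain ⟨x, hx1, hx2⟩ := EReal.lt_iff_exists_real_btwn.1 (hN.trans_le (hhM ω hω))
      have hx1' : processLiminf (T.upperExp h) ω < ((x - δ : ℝ) : EReal) := by
        rw [EReal.coe_sub]
        exact (EReal.lt_sub_iff_add_lt (by simp) (by simp)).2 hx1
      obtain ⟨n, hn1, hn2, hn3⟩ := ((frequently_lt_of_liminf_lt (by isBoundedDefault) hx1').and_eventually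
        ((eventually_lt_of_lt_liminf hx2).and (eventually_ge_atTop u.length))).exists
      refine ⟨n, hn3, (hr _).trans_lt ?_⟩
      rw [hv] at hn1
      have hn1 : v (ω.initial n) < x - δ := by exact_mod_cast hn1
      refine lt_of_le_of_lt ?_ (EReal.add_lt_add_right_coe hn2 r')
      exact_mod_cast (by linarith : v (ω.initial n) + r ≤ x + r')
    · left
      have : φ ω = h ω := by simp [hφ, hN]
      rw [this]
      exact (hhM ω hω).trans (processLiminf_mono
        (fun _ => le_add_of_nonneg_right (by exact_mod_cast hr'0)) ω)
  -- The excess starts at `C + c - B` at most and loses `δ` per round, so it vanishes after finitely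
  -- many rounds.
  have iter : ∀ k : ℕ, ∀ u, T.upperExp φ u ≤
      ((v u + max 0 (C + c - B - k * δ) : ℝ) : EReal) := by
    intro k
    induction k with
    | zero =>
      intro u
      refine (upperExp_le_const fun ω _ => hφC ω).trans (EReal.coe_le_coe ?_)
      have := le_max_right 0 (C + c - B - (0 : ℕ) * δ)
      have := hvB u
      push_cast at *
      linarith
    | succ k ih =>
      intro u
      refine (step _ (le_max_left _ _) ih u).trans (EReal.coe_le_coe ?_)
      refine add_le_add_right (max_le (le_max_left _ _) ?_) _
      rcases le_total 0 (C + c - B - k * δ) with h0 | h0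
      · rw [max_eq_right h0]
        refine le_trans (le_of_eq ?_) (le_max_right _ _)
        push_cast; ring
      · rw [max_eq_left h0]
        exact le_trans (by linarith) (le_max_left _ _)
  obtain ⟨k, hk⟩ := exists_nat_gt ((C + c - B) / δ)
  have hk' : C + c - B - k * δ ≤ 0 := by
    rw [div_lt_iff₀ hδ] at hk
    linarith
  have := iter k t
  rwa [max_eq_left hk', add_zero, ← hv] at this

/-- A cheap non-negative supermartingale that becomes large on all the paths along which the
conditional upper expectations of `h` stay below `h`. -/
theorem exists_supermartingale_large {h : Path X → EReal} {B C δ : ℝ}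
    (hB : ∀ ω, (B : EReal) ≤ h ω) (hC : ∀ ω, h ω ≤ (C : EReal)) (hδ : 0 < δ)
    (s : Situation X) {ε K : ℝ} (hε : 0 < ε) (hK : 0 ≤ K) :
    ∃ L, T.IsSupermartingale L ∧ (∀ u, 0 ≤ L u) ∧ L s ≤ (ε : EReal) ∧
      ∀ ω ∈ cylinder s, processLiminf (T.upperExp h) ω + (δ : EReal) < h ω →
        ∀ᶠ n in atTop, (K : EReal) ≤ L (ω.initial n) := by
  classical
  have hBC : B < C + 1 := by
    obtain ⟨ω⟩ : Nonempty (Path X) := inferInstance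
    have : B ≤ C := by exact_mod_cast (hB ω).trans (hC ω)
    linarith
  -- The superhedge `L` of the raised variable starts below `C + 1`, so `r * (L - B)` starts below
  -- `ε`. On raised paths `L - B` eventually exceeds `K / r`, because `c > K / r`.
  set r := ε / (C + 1 - B) with hr
  have hr0 : 0 < r := div_pos hε (by linarith)
  set c := K / r + 1 with hc
  have hc0 : 0 ≤ c := by positivity
  have hlt := (upperExp_raise_le (T := T) hB hC hδ hc0 s).trans_lt
    ((upperExp_le_const fun ω _ => hC ω).trans_lt
      (EReal.coe_lt_coe (show C < C + 1 by linarith)))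
  obtain ⟨L, hL, hLB, hLφ, hLs⟩ := exists_superhedge (B := B) (fun ω => by
    split_ifs
    · exact (hB ω).trans (le_add_of_nonneg_right (by exact_mod_cast hc0))
    · exact hB ω) hlt
  have hb : IsBddBelow L := ⟨B, hLB⟩
  have key : ∀ {x y : EReal} {a : ℝ}, x ≤ y → (a : EReal) ≤ x →
      ((r * (a - B) : ℝ) : EReal) ≤ (r : EReal) * (y + ((-B : ℝ) : EReal)) := by
    intro x y a hxy hax
    rw [EReal.coe_mul, sub_eq_add_neg, EReal.coe_add]
    exact mul_le_mul_of_nonneg_left (add_le_add_left (hax.trans hxy) _) (by exact_mod_cast hr0.le)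
  refine ⟨fun u => (r : EReal) * (L u + ((-B : ℝ) : EReal)),
    (hL.add_const hb _).const_mul (hb.add_const _) hr0, fun u => ?_, ?_, fun ω hω hN => ?_⟩
  · simpa using key le_rfl (hLB u)
  · refine (mul_le_mul_of_nonneg_left (add_le_add_left hLs.le _)
      (by exact_mod_cast hr0.le)).trans ?_
    rw [← EReal.coe_add, ← EReal.coe_mul, ← sub_eq_add_neg, hr,
      div_mul_cancel₀ _ (by linarith : C + 1 - B ≠ 0)]
  · have h1 := hLφ ω hω
    rw [if_pos hN] at h1
    have h2 : ((B + K / r : ℝ) : EReal) < processLiminf L ω := by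
      refine lt_of_lt_of_le ?_ ((add_le_add_left (hB ω) (c : EReal)).trans h1)
      exact_mod_cast (by rw [hc]; linarith : B + K / r < B + c)
    filter_upwards [eventually_lt_of_lt_liminf h2] with n hn
    refine le_trans (EReal.coe_le_coe (le_of_eq ?_)) (key hn.le le_rfl)
    field_simp
    ring

/-- Upward continuity along a non-decreasing sequence of gambles. -/
theorem upperExp_le_iSup {h : ℕ → Path X → EReal} {f : Path X → EReal} {B : ℝ} {C : ℕ → ℝ}
    (hB : ∀ m ω, (B : EReal) ≤ h m ω) (hC : ∀ m ω, h m ω ≤ (C m : EReal)) (hmono : Monotone h)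
    (hf : ∀ ω, f ω ≤ ⨆ m, h m ω) (s : Situation X) :
    T.upperExp f s ≤ ⨆ m, T.upperExp (h m) s := by
  set V : Situation X → EReal := fun u => ⨆ m, T.upperExp (h m) u with hVdef
  have hVm : ∀ m u, T.upperExp (h m) u ≤ V u := fun m u => le_iSup (fun m => T.upperExp (h m) u) m
  have hEB : ∀ m u, (B : EReal) ≤ T.upperExp (h m) u := fun m u => le_upperExp fun ω _ => hB m ω
  have hVB : ∀ u, (B : EReal) ≤ V u := fun u => (hEB 0 u).trans (hVm 0 u)
  have hEmono : ∀ u, Monotone fun m => T.upperExp (h m) u := fun u m n hmn =>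
    upperExp_mono fun ω _ => hmono hmn ω
  have hV : T.IsSupermartingale V := fun u =>
    (T.isUpperExpectation u).le_of_monotone_limit (B := B)
      (f := fun m x => T.upperExp (h m) (u ++ [x])) (fun m x => hEB m _)
      (fun m x => hEmono _ m.le_succ) (fun x => tendsto_atTop_iSup (hEmono _))
      fun m => (isSupermartingale_upperExp ⟨B, hB m⟩ u).trans (hVm m u)
  have main : ∀ δ : ℝ, 0 < δ → T.upperExp f s ≤ V s + (δ : EReal) + (δ : EReal) := by
    intro δ hδ
    -- The `m`-th correction costs at most `ε m`, for a total of at most `δ`, and eventually reaches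
    -- `m` on its exceptional paths.
    obtain ⟨ε, hε0, hεsum⟩ := ENNReal.exists_pos_sum_of_countable
      (ε := ENNReal.ofReal δ) (by simpa using hδ) ℕ
    choose L hL hL0 hLs hLN using fun m : ℕ =>
      exists_supermartingale_large (T := T) (hB m) (hC m) hδ s (ε := ε m) (K := m)
        (by exact_mod_cast hε0 m) (by positivity)
    set S : Situation X → EReal := fun u => ((∑' m, (L m u).toENNReal : ENNReal) : EReal) with hS
    have hS0 : ∀ u, 0 ≤ S u := fun u => EReal.coe_ennreal_nonneg _
    have hLS : ∀ m u, L m u ≤ S u := fun m u => by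
      rw [← EReal.coe_toENNReal (hL0 m u)]
      exact EReal.coe_ennreal_le_coe_ennreal_iff.2 (ENNReal.le_tsum m)
    have hSs : S s ≤ (δ : EReal) := by
      rw [← max_eq_left hδ.le, ← EReal.coe_ennreal_ofReal, EReal.coe_ennreal_le_coe_ennreal_iff]
      refine le_trans (ENNReal.tsum_le_tsum fun m => ?_) hεsum.le
      rw [← EReal.coe_ennreal_le_coe_ennreal_iff, EReal.coe_toENNReal (hL0 m s)]
      exact hLs m
    have hVδ : IsBddBelow fun u => V u + (δ : EReal) := IsBddBelow.add_const ⟨B, hVB⟩ δ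
    have hVδB : ∀ u, (B : EReal) ≤ V u + (δ : EReal) := fun u =>
      (hVB u).trans (le_add_of_nonneg_right (by exact_mod_cast hδ.le))
    have hSb : IsBddBelow S := ⟨0, hS0⟩
    refine (upperExp_le ((hV.add_const ⟨B, hVB⟩ δ).add (IsSupermartingale.tsum hL hL0) hVδ hSb)
      ⟨B, fun u => (hVδB u).trans (le_add_of_nonneg_right (hS0 u))⟩
      fun ω hω => ?_).trans (add_le_add_right hSs _)
    by_cases hN : processLiminf V ω + (δ : EReal) < f ω
    · refine le_top.trans (top_le_iff.2 ((EReal.eq_top_iff_forall_lt _).2 fun y => ?_))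
      obtain ⟨m₀, hm₀⟩ := lt_iSup_iff.1 (hN.trans_le (hf ω))
      obtain ⟨m₁, hm₁⟩ := exists_nat_gt (y - B)
      set m := max m₀ m₁
      have hm : processLiminf (T.upperExp (h m)) ω + (δ : EReal) < h m ω :=
        (add_le_add_left (processLiminf_mono (hVm m) ω) _).trans_lt
          (hm₀.trans_le (hmono (le_max_left _ _) ω))
      refine lt_of_lt_of_le (b := ((B + m : ℝ) : EReal)) ?_ ?_
      · have : (m₁ : ℝ) ≤ m := by exact_mod_cast le_max_right m₀ m₁
        exact_mod_cast (by linarith : y < B + m)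
      · refine le_liminf_of_le (by isBoundedDefault) ?_
        filter_upwards [hLN m ω hω hm] with n hn
        rw [EReal.coe_add]
        exact add_le_add (hVδB _) (hn.trans (hLS m _))
    · exact (not_lt.1 hN).trans ((processLiminf_add_const_le V δ ω).trans
        (processLiminf_mono (fun u => le_add_of_nonneg_right (hS0 u)) ω))
  refine EReal.le_of_forall_lt_iff_le.1 fun a ha => ?_
  change V s < a at ha
  have hlow := hVB s
  lift V s to ℝ using
    ⟨(ha.trans (EReal.coe_lt_top _)).ne, ((EReal.bot_lt_coe _).trans_le hlow).ne'⟩ with v hv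
  have hva : v < a := by exact_mod_cast ha
  have := main ((a - v) / 2) (by linarith)
  refine this.trans (le_of_eq ?_)
  rw [← EReal.coe_add, ← EReal.coe_add]
  congr 1
  ring

end ImpreciseProbabilitiesTree

/-! ### Finitary gambles and compactness -/

section Finitary

variable {X : Type u}

theorem IsNMeasurable.eq_of_initial_eq {n : ℕ} {f : Path X → EReal} (hf : IsNMeasurable n f)
    {ω ω' : Path X} (h : ω'.initial n = ω.initial n) : f ω' = f ω :=
  hf (ω.initial n) (by simp) ω' (by simpa [cylinder] using h) ω (ω.mem_cylinder_initial n)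

theorem IsNMeasurable.mono {m n : ℕ} {f : Path X → EReal} (hf : IsNMeasurable m f) (h : m ≤ n) :
    IsNMeasurable n f := by
  rintro s rfl ω hω ω' hω'
  refine hf.eq_of_initial_eq ?_
  rw [← ω.take_initial h, ← ω'.take_initial h, show ω.initial s.length = s from hω,
    show ω'.initial s.length = s from hω']

/-- König's lemma: a non-decreasing sequence of clopen sets that covers a cylinder covers it at
some finite stage. -/
theorem exists_stage_of_cover [Finite X] {s : Situation X} {P : ℕ → Path X → Prop}
    (hfin : ∀ n, ∃ k, ∀ ω ω' : Path X, ω'.initial k = ω.initial k → P n ω → P n ω')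
    (hmono : ∀ m n, m ≤ n → ∀ ω, P m ω → P n ω) (hcover : ∀ ω ∈ cylinder s, ∃ n, P n ω) :
    ∃ n, ∀ ω ∈ cylinder s, P n ω := by
  -- With the finite set `X` discrete, the path space is compact in the product topology and sets
  -- fixed by finitely many states are open.
  let _ : TopologicalSpace X := ⊥
  have : DiscreteTopology X := ⟨rfl⟩
  have hopen : ∀ Q : Path X → Prop,
      (∃ k, ∀ ω ω' : Path X, ω'.initial k = ω.initial k → Q ω → Q ω') → IsOpen {ω | Q ω} := by
    rintro Q ⟨k, hk⟩
    refine isOpen_iff_mem_nhds.2 fun ω hω => ?_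
    have hnhds : (⋂ i ∈ Finset.range k, {ω' : Path X | ω' i = ω i}) ∈ 𝓝 ω :=
      (Finset.iInter_mem_sets _).2 fun i _ =>
        ((isOpen_discrete ({ω i} : Set X)).preimage (continuous_apply i)).mem_nhds
          (Set.mem_singleton (ω i))
    refine mem_of_superset hnhds fun ω' hω' => hk ω ω' ?_ hω
    refine List.map_congr_left fun i hi => ?_
    exact Set.mem_iInter₂.1 hω' i (by simpa using hi)
  have hclosed : IsClosed (cylinder s) := by
    refine ⟨hopen (fun ω => ω ∉ cylinder s) ⟨s.length, fun ω ω' h hω hω' => hω ?_⟩⟩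
    exact (h.symm.trans hω' : ω.initial s.length = s)
  obtain ⟨n, hn⟩ := hclosed.isCompact.elim_directed_cover (fun n => {ω | P n ω})
    (fun n => hopen _ (hfin n)) (fun ω hω => Set.mem_iUnion.2 (hcover ω hω))
    (directed_of_isDirected_le fun m n hmn ω hω => hmono m n hmn ω hω)
  exact ⟨n, hn⟩

end Finitary

/-! ### Downward continuity by compactness -/

namespace ImpreciseProbabilitiesTree

variable {X : Type u} {T : ImpreciseProbabilitiesTree X} [Finite X] [Nonempty X]

/-- Downward continuity along a non-increasing sequence of finitary variables. -/
theorem exists_upperExp_le_of_antitone {H : ℕ → Path X → EReal} {h : Path X → EReal} {B : ℝ}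
    {m : ℕ} (hB : ∀ n ω, (B : EReal) ≤ H n ω) (hH : ∀ n, m ≤ n → IsNMeasurable n (H n))
    (hfin : ∀ n, m ≤ n → ∀ ω, H n ω < ⊤) (hanti : Antitone H) (hh : ∀ ω, h ω = ⨅ n, H n ω) {s : Situation X} {a : EReal} {ε : ℝ}
    (hε : 0 < ε) (ha : T.upperExp h s < a) : ∃ n, T.upperExp (H n) s ≤ a + (ε : EReal) := by
  have hhB : ∀ ω, (B : EReal) ≤ h ω := fun ω => by rw [hh]; exact le_iInf fun n => hB n ω
  obtain ⟨M, hM, hMB, hhM, hMa⟩ := exists_superhedge hhB ha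
  -- At such a time `k`, `M + ε` exceeds `H k`, whose value is already settled by the first `k`
  -- states. Compactness bounds these times by one `n`; since `H n ≤ H k`, switching at time `k`
  -- then superhedges `H n`.
  let Q : ℕ → Path X → Prop := fun k ω =>
    s.length ≤ k ∧ m ≤ k ∧ H k ω < M (ω.initial k) + (ε : EReal)
  obtain ⟨n, hn⟩ := exists_stage_of_cover (s := s) (P := fun n ω => ∃ k ≤ n, Q k ω)
    (fun n => ⟨n, fun ω ω' h => by
      rintro ⟨k, hkn, hsk, hmk, hk⟩
      have hk' : ω'.initial k = ω.initial k := by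
        rw [← ω.take_initial hkn, ← ω'.take_initial hkn, h]
      refine ⟨k, hkn, hsk, hmk, ?_⟩
      rwa [hk', (hH k hmk).eq_of_initial_eq hk']⟩)
    (fun i j hij ω ⟨k, hk, hQ⟩ => ⟨k, hk.trans hij, hQ⟩) (fun ω hω => by
      have hlt : h ω < processLiminf (fun u => M u + (ε : EReal)) ω := by
        refine lt_of_lt_of_le ?_ ((add_le_add_left (hhM ω hω) _).trans
          (processLiminf_add_const_le M ε ω))
        -- Finiteness is what makes adding `ε` a strict increase.
        have htop : h ω ≠ ⊤ := by
          rw [hh]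
          exact ((iInf_le _ m).trans_lt (hfin m le_rfl ω)).ne
        lift h ω to ℝ using ⟨htop, ((EReal.bot_lt_coe _).trans_le (hhB ω)).ne'⟩ with y
        exact_mod_cast (by linarith : y < y + ε)
      obtain ⟨x, hx1, hx2⟩ := EReal.lt_iff_exists_real_btwn.1 hlt
      rw [hh] at hx1
      obtain ⟨n₀, hn₀⟩ := iInf_lt_iff.1 hx1
      obtain ⟨k, hk, hk1, hk2, hk3⟩ := ((eventually_lt_of_lt_liminf hx2).and
        ((eventually_ge_atTop s.length).and ((eventually_ge_atTop m).and
          (eventually_ge_atTop n₀)))).exists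
      exact ⟨k, k, le_rfl, hk1, hk2, (hanti hk3 ω).trans_lt (hn₀.trans hk)⟩)
  refine ⟨n, ?_⟩
  have hb : IsBddBelow M := ⟨B, hMB⟩
  refine (upperExp_le_of_stopping ⟨B, hB n⟩ (hM.add_const hb ε) (hb.add_const ε)
    fun ω hω => ?_).trans (add_le_add_left hMa.le _)
  obtain ⟨k, hkn, hsk, hmk, hk⟩ := hn ω hω
  refine Or.inr ⟨k, hsk, lt_of_le_of_lt ?_ hk⟩
  have hconst : ∀ ω' ∈ cylinder (ω.initial k), H n ω' ≤ H k ω := fun ω' hω' => by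
    refine (hanti hkn ω').trans (le_of_eq ((hH k hmk).eq_of_initial_eq ?_))
    simpa [cylinder] using hω'
  refine le_trans (upperExp_mono (g := fun _ => H k ω) hconst) ?_
  refine EReal.le_of_forall_lt_iff_le.1 fun c hc => upperExp_le_const fun _ _ => hc.le

end ImpreciseProbabilitiesTree

/-- A bounded below limit of finitary variables is the limit of a sequence of gambles that are
uniformly bounded below, the `n`-th of which is `n`-measurable. -/
theorem exists_measurable_approximation {X : Type u} {f : Path X → EReal}
    (hf : f ∈ boundedLimits X) :
    ∃ (B : ℝ) (C : ℕ → ℝ) (G : ℕ → Path X → EReal), (∀ n ω, (B : EReal) ≤ G n ω) ∧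
      (∀ n ω, G n ω ≤ (C n : EReal)) ∧ (∀ n, IsNMeasurable n (G n)) ∧ ConvergesPointwise G f := by
  obtain ⟨⟨B, hB⟩, g, hg, hlim⟩ := hf
  choose p hp using hg
  -- The constant put in front is `0`-measurable, so every `n` admits an index `j` with `p' j ≤ n`.
  let g' : ℕ → Path X → EReal := fun
    | 0 => fun _ => (B : EReal)
    | j + 1 => g j
  let p' : ℕ → ℕ := fun
    | 0 => 0
    | j + 1 => p j
  have hp' : ∀ j, IsNMeasurable (p' j) (g' j) := fun j => by
    cases j with
    | zero => exact fun _ _ _ _ _ _ => rfl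
    | succ j => exact hp j
  -- Delays the sequence until its `k n`-th term is `n`-measurable.
  let k : ℕ → ℕ := fun n => Nat.findGreatest (fun j => p' j ≤ n) n
  have hpk : ∀ n, p' (k n) ≤ n := fun n =>
    Nat.findGreatest_spec (P := fun j => p' j ≤ n) (Nat.zero_le n) (Nat.zero_le n)
  have hk : Tendsto k atTop atTop := tendsto_atTop.2 fun J => by
    filter_upwards [eventually_ge_atTop J, eventually_ge_atTop (p' J)] with n h1 h2
    exact Nat.le_findGreatest h1 h2
  -- Truncation between `B` and `n` gives gambles; the limit is unchanged because `f ≥ B` and the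
  -- upper level tends to `⊤`.
  refine ⟨B, fun n => max B n, fun n ω => max (B : EReal) (min (g' (k n) ω) ((n : ℝ) : EReal)),
    fun n ω => le_max_left _ _, fun n ω => ?_, fun n s hs ω hω ω' hω' => ?_, fun ω => ?_⟩
  · exact max_le (EReal.coe_le_coe (le_max_left _ _))
      ((min_le_right _ _).trans (EReal.coe_le_coe (le_max_right _ _)))
  · simp only [(hp' (k n)).mono (hpk n) s hs ω hω ω' hω']
  · have h1 : Tendsto (fun j => g' j ω) atTop (𝓝 (f ω)) :=
      (tendsto_add_atTop_iff_nat 1).1 (hlim ω)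
    have h2 : Tendsto (fun n : ℕ => ((n : ℝ) : EReal)) atTop (𝓝 ⊤) :=
      EReal.tendsto_coe_nhds_top_iff.2 tendsto_natCast_atTop_atTop
    have h3 := (tendsto_const_nhds (x := (B : EReal))).max ((h1.comp hk).min h2)
    rwa [min_eq_left le_top, max_eq_right (hB ω)] at h3

end GameTheoretic

/-! ### The diagonal sequence -/

open GameTheoretic ImpreciseProbabilitiesTree in
theorem mainTheorem2 {X : Type*} [Finite X] [Nonempty X]
    (T : GameTheoretic.ImpreciseProbabilitiesTree X) (s : GameTheoretic.Situation X)
    (f : GameTheoretic.Path X → EReal) (hf : f ∈ GameTheoretic.boundedLimits X) :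
    ∃ F : ℕ → GameTheoretic.Path X → EReal,
      (∀ n, GameTheoretic.IsGamble (F n) ∧ GameTheoretic.IsNMeasurable n (F n)) ∧
      GameTheoretic.IsUniformlyBddBelow F ∧
      GameTheoretic.ConvergesPointwise F f ∧
      Tendsto (fun n => T.upperExp (F n) s) atTop (𝓝 (T.upperExp f s)) := by
  obtain ⟨B, C, G, hGB, hGC, hGm, hGf⟩ := exists_measurable_approximation hf
  -- For `n < m` the infimum is empty and equals `⊤`, so upper bounds on `H m n` need `m ≤ n`.
  let H : ℕ → ℕ → Path X → EReal := fun m n ω => ⨅ i, ⨅ _ : m ≤ i ∧ i ≤ n, G i ω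
  let h : ℕ → Path X → EReal := fun m ω => ⨅ i, ⨅ _ : i ≥ m, G i ω
  have hHB : ∀ m n ω, (B : EReal) ≤ H m n ω := fun m n ω => le_iInf₂ fun i _ => hGB i ω
  have hhB : ∀ m ω, (B : EReal) ≤ h m ω := fun m ω => le_iInf₂ fun i _ => hGB i ω
  have hHG : ∀ m n i, m ≤ i → i ≤ n → ∀ ω, H m n ω ≤ G i ω := fun m n i h1 h2 ω =>
    iInf₂_le i ⟨h1, h2⟩
  have hhG : ∀ m ω, h m ω ≤ G m ω := fun m ω => iInf₂_le m le_rfl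
  have hhH : ∀ m n ω, h m ω ≤ H m n ω := fun m n ω => le_iInf₂ fun i hi => iInf₂_le i hi.1
  have hHC : ∀ m n, m ≤ n → ∀ ω, H m n ω ≤ (C m : EReal) := fun m n hmn ω =>
    (hHG m n m le_rfl hmn ω).trans (hGC m ω)
  have hhC : ∀ m ω, h m ω ≤ (C m : EReal) := fun m ω => (hhG m ω).trans (hGC m ω)
  have hHm : ∀ m n, IsNMeasurable n (H m n) := fun m n t ht ω hω ω' hω' =>
    iInf_congr fun i => iInf_congr fun hi => (hGm i).mono hi.2 t ht ω hω ω' hω'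
  have hHanti : ∀ m, Antitone (H m) := fun m n n' hn ω =>
    le_iInf₂ fun i hi => iInf₂_le i ⟨hi.1, hi.2.trans hn⟩
  have hhmono : Monotone h := fun m m' hm ω =>
    le_iInf₂ fun i hi => iInf₂_le i (le_trans hm hi)
  have hhinf : ∀ m ω, h m ω = ⨅ n, H m n ω := fun m ω =>
    le_antisymm (le_iInf fun n => hhH m n ω)
      (le_iInf₂ fun i hi => (iInf_le _ i).trans (hHG m i i hi le_rfl ω))
  have hsup : ∀ ω, f ω = ⨆ m, h m ω := fun ω => by
    rw [← (hGf ω).liminf_eq, liminf_eq_iSup_iInf_of_nat]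
  have hhlim : ∀ ω, Tendsto (fun m => h m ω) atTop (𝓝 (f ω)) := fun ω => by
    rw [hsup]
    exact tendsto_atTop_iSup fun m m' hm => hhmono hm ω
  have hE : T.upperExp f s = ⨆ m, T.upperExp (h m) s :=
    le_antisymm (upperExp_le_iSup hhB hhC hhmono (fun ω => (hsup ω).le) s)
      (iSup_le fun m => upperExp_mono fun ω _ => (le_iSup (fun m => h m ω) m).trans (hsup ω).ge)
  have hElim : Tendsto (fun m => T.upperExp (h m) s) atTop (𝓝 (T.upperExp f s)) := by
    rw [hE]
    exact tendsto_atTop_iSup fun m m' hm => upperExp_mono fun ω _ => hhmono hm ω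
  have hstage : ∀ m : ℕ, ∃ N, ∀ n, N ≤ n →
      T.upperExp (H m n) s ≤ T.upperExp (h m) s + ((1 / ((m : ℝ) + 1) : ℝ) : EReal) := by
    intro m
    -- One half of the tolerance gives the strict inequality that downward continuity asks for, the
    -- other half is its `ε`.
    have hm : (0 : ℝ) < 1 / ((m : ℝ) + 1) / 2 := by positivity
    obtain ⟨e, he⟩ : ∃ e : ℝ, (e : EReal) = T.upperExp (h m) s := by
      have h1 : (B : EReal) ≤ T.upperExp (h m) s := le_upperExp fun ω _ => hhB m ω
      have h2 : T.upperExp (h m) s ≤ C m := upperExp_le_const fun ω _ => hhC m ω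
      exact ⟨_, EReal.coe_toReal (h2.trans_lt (EReal.coe_lt_top _)).ne
        ((EReal.bot_lt_coe _).trans_le h1).ne'⟩
    obtain ⟨N, hN⟩ := exists_upperExp_le_of_antitone (T := T) (s := s)
      (a := ((e + 1 / ((m : ℝ) + 1) / 2 : ℝ) : EReal)) (hHB m)
      (fun n _ => hHm m n) (fun n hn ω => (hHC m n hn ω).trans_lt (EReal.coe_lt_top _))
      (hHanti m) (hhinf m) hm (by rw [← he]; exact EReal.coe_lt_coe (by linarith))
    refine ⟨N, fun n hn => (upperExp_mono fun ω _ => hHanti m hn ω).trans (hN.trans ?_)⟩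
    rw [← he, ← EReal.coe_add, ← EReal.coe_add]
    exact EReal.coe_le_coe (by linarith)
  choose N hN using hstage
  -- The largest `m ≤ n` whose threshold `N m` has been passed; `k n ≤ n` keeps the window of `H (k
  -- n) n` non-empty.
  let k : ℕ → ℕ := fun n => Nat.findGreatest (fun m => N m ≤ n) n
  have hkn : ∀ n, k n ≤ n := fun n => Nat.findGreatest_le n
  have hk : Tendsto k atTop atTop := tendsto_atTop.2 fun J => by
    filter_upwards [eventually_ge_atTop J, eventually_ge_atTop (N J)] with n h1 h2
    exact Nat.le_findGreatest h1 h2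
  refine ⟨fun n => H (k n) n, fun n => ⟨⟨fun ω => ?_, ⟨B, hHB _ n⟩, ⟨_, hHC _ n (hkn n)⟩⟩, hHm _ n⟩,
    ⟨B, fun n => hHB _ n⟩, fun ω => ?_, ?_⟩
  · exact ⟨_, (EReal.coe_toReal ((hHC _ n (hkn n) ω).trans_lt (EReal.coe_lt_top _)).ne
      ((EReal.bot_lt_coe _).trans_le (hHB _ n ω)).ne').symm⟩
  -- Squeeze: `h (k n) ≤ H (k n) n ≤ G n`, and both ends tend to `f`.
  · exact tendsto_of_tendsto_of_tendsto_of_le_of_le ((hhlim ω).comp hk) (hGf ω)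
      (fun n => hhH _ n ω) (fun n => hHG _ n n (hkn n) le_rfl ω)
  · have hzero : Tendsto (fun m : ℕ => ((1 / ((m : ℝ) + 1) : ℝ) : EReal)) atTop
        (𝓝 ((0 : ℝ) : EReal)) :=
      (continuous_coe_real_ereal.tendsto 0).comp tendsto_one_div_add_atTop_nhds_zero_nat
    have hupper : Tendsto
        (fun m : ℕ => T.upperExp (h m) s + ((1 / ((m : ℝ) + 1) : ℝ) : EReal)) atTop
        (𝓝 (T.upperExp f s)) := by
      have := (EReal.continuousAt_add (p := (T.upperExp f s, ((0 : ℝ) : EReal))) (by simp)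
        (by simp)).tendsto.comp (hElim.prodMk_nhds hzero)
      simpa [Function.comp_def] using this
    refine tendsto_of_tendsto_of_tendsto_of_le_of_le' (hElim.comp hk) (hupper.comp hk)
      (Eventually.of_forall fun n => upperExp_mono fun ω _ => hhH _ n ω) ?_
    -- Before `N 0` the value `k n = 0` may be a mere default, for which `N (k n) ≤ n` can fail.
    filter_upwards [eventually_ge_atTop (N 0)] with n hn
    exact hN _ n (Nat.findGreatest_spec (P := fun m => N m ≤ n) (Nat.zero_le n) hn)
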